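/- Let $n,m,\gamma\ge 0$ be integers, and let $p(x,y,\theta)\in\mathbb R^n$ and $q(x,y,\theta)\in\mathbb R$ be real-analytic functions defined in a neighborhood of $0$ in $\mathbb R\times\mathbb R^n\times\mathbb R^m$, such that $\theta\mapsto q(0,0,\theta)$ does not vanish identically on any neighborhood of $0$ in $\mathbb R^m$. Consider the singular differential equation, for an $\mathbb R^n$-valued function $y(x,\theta)$ with $x\in\mathbb R$, $\theta\in\mathbb R^m$, $$x^{\gamma+1}\,\partial_x y(x,\theta)=\frac{p(x,y(x,\theta),\theta)}{q(x,y(x,\theta),\theta)}. \qquad (*)$$ By a solution we mean a function $y$ that is real-analytic in $(x,\theta)$ in a neighborhood of $(0,0)$ and satisfies $(*)$ at all points $(x,\theta)$ sufficiently close to $(0,0)$ at which $q(x,y(x,\theta),\theta)\neq 0$. Let $\hat y$ be a solution with $\hat y(0,\theta)=0$ for all $\theta$ near $0$. Then there exists an integer $k\ge 0$ (independent of $y$) such that every solution $y$ satisfying $$\partial_x^l y(0,\theta)=\partial_x^l\hat y(0,\theta)\quad\text{for all }\theta\text{ near }0\text{ and all }0\le l\le k$$ coincides with $\hat y$ in a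 neighborhood of $(0,0)$. -/

import Mathlib

open Filter Topology

/-- `IsAnalyticSolution γ p q y`: the germ at the origin of `y = y(x, θ)`, with `x ∈ ℝ`, `θ ∈ ℝᵐ`
and values in `ℝⁿ`, is real-analytic (jointly in `(x, θ)`) and solves
`x ^ (γ + 1) ∂ₓ y(x, θ) = p(x, y(x, θ), θ) / q(x, y(x, θ), θ)`
at all points `(x, θ)` near the origin at which the denominator does not vanish. -/
def IsAnalyticSolution {n m : ℕ} (γ : ℕ)
    (p : ℝ × (Fin n → ℝ) × (Fin m → ℝ) → (Fin n → ℝ))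
    (q : ℝ × (Fin n → ℝ) × (Fin m → ℝ) → ℝ)
    (y : ℝ × (Fin m → ℝ) → (Fin n → ℝ)) : Prop :=
  AnalyticAt ℝ y (0, 0) ∧
    ∀ᶠ z : ℝ × (Fin m → ℝ) in 𝓝 (0, 0),
      q (z.1, y z, z.2) ≠ 0 →
        z.1 ^ (γ + 1) • deriv (fun x : ℝ => y (x, z.2)) z.1 =
          (q (z.1, y z, z.2))⁻¹ • p (z.1, y z, z.2)

/-! Expand in powers of `x`, with coefficients in the ring of germs at `0` of analytic functions of
`θ`. That ring is an integral domain of characteristic zero, so `q` need not be invertible: it is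
enough that its series along the solution `yhat` is nonzero.

Put `u = y - yhat` and suppose `u` has finite order `N` in `x`. Clearing the denominator and
applying Taylor's formula at `yhat` gives a linear system `D • euler u = M u` modulo `X ^ (2 * N)`,
where `D ≠ 0` and `M` depend only on `yhat` (`exists_linearization`). On the other hand, for large
`N` such a system holds at best modulo `X ^ (N + K)`, with `K` determined by `D` and `M`
(`exists_order_bound`). Hence `2 * N ≤ N + K`, so agreement of the jets up to order `K` forces `u =
0`.

The order bound comes from elimination: each component of `u` satisfies, to the same accuracy, a
nontrivial scalar equation in the Euler derivation, and the indicial polynomial of that equation has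
only finitely many integer roots. -/

namespace PowerSeries

/-! ### Formal linear systems and the order bound. -/

section Euler

variable {R : Type*} [CommRing R]

/-- The Euler derivation `X d/dX` of formal power series. -/
noncomputable def euler (R : Type*) [CommRing R] : Derivation R R⟦X⟧ R⟦X⟧ :=
  (X : R⟦X⟧) • derivative R

theorem euler_apply (f : R⟦X⟧) : euler R f = X * derivative R f := rfl

theorem coeff_euler (k : ℕ) (f : R⟦X⟧) : coeff k (euler R f) = k * coeff k f := by
  rw [euler_apply]
  cases k with
  | zero => simp
  | succ k => rw [coeff_succ_X_mul, coeff_derivative]; push_cast; ring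

theorem coeff_euler_iterate (j k : ℕ) (f : R⟦X⟧) :
    coeff k ((euler R)^[j] f) = (k : R) ^ j * coeff k f := by
  induction j with
  | zero => simp
  | succ j ih => rw [Function.iterate_succ_apply', coeff_euler, ih]; ring

theorem X_pow_dvd_euler {r : ℕ} {f : R⟦X⟧} (h : X ^ r ∣ f) : X ^ r ∣ euler R f := by
  rw [X_pow_dvd_iff] at *
  intro k hk
  rw [coeff_euler, h k hk, mul_zero]

theorem X_pow_dvd_euler_iterate {r : ℕ} {f : R⟦X⟧} (h : X ^ r ∣ f) (j : ℕ) :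
    X ^ r ∣ (euler R)^[j] f := by
  induction j with
  | zero => simpa
  | succ j ih => rw [Function.iterate_succ_apply']; exact X_pow_dvd_euler ih

/-- The Leibniz rule, by induction on `J`. The leading coefficient `D ^ J` is what later keeps the
scalar equation nontrivial. -/
theorem exists_iterate_smul_euler_eq (D : R⟦X⟧) (J : ℕ) :
    ∃ d : ℕ → R⟦X⟧, d J = D ^ J ∧ (∀ k, J < k → d k = 0) ∧
      ∀ f, (D • euler R)^[J] f = ∑ k ∈ Finset.range (J + 1), d k * (euler R)^[k] f := by
  induction J with
  | zero =>
    refine ⟨fun k => if k = 0 then 1 else 0, by simp, fun k hk => by simp [hk.ne'], by simp⟩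
  | succ J ih =>
    obtain ⟨d, h1, h2, h3⟩ := ih
    let d' : ℕ → R⟦X⟧ := fun k => D * euler R (d k) + match k with
      | 0 => 0
      | k + 1 => D * d k
    refine ⟨d', ?_, ?_, fun f => ?_⟩
    · simp [d', h1, h2 (J + 1) (Nat.lt_succ_self J), pow_succ']
    · rintro (_ | k) hk
      · omega
      · simp [d', h2 k (by omega), h2 (k + 1) (by omega)]
    · rw [Function.iterate_succ_apply', h3]
      have key : (D • euler R) (∑ k ∈ Finset.range (J + 1), d k * (euler R)^[k] f) =
          ∑ k ∈ Finset.range (J + 1), (D * euler R (d k) * (euler R)^[k] f) +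
            ∑ k ∈ Finset.range (J + 1), (D * d k * (euler R)^[k + 1] f) := by
        rw [map_sum, ← Finset.sum_add_distrib]
        refine Finset.sum_congr rfl fun k _ => ?_
        rw [Function.iterate_succ_apply']
        simp only [Derivation.smul_apply, Derivation.leibniz, smul_eq_mul]
        ring
      have e1 : ∑ k ∈ Finset.range (J + 2), (D * euler R (d k) * (euler R)^[k] f) =
          ∑ k ∈ Finset.range (J + 1), (D * euler R (d k) * (euler R)^[k] f) := by
        rw [Finset.sum_range_succ, h2 (J + 1) (Nat.lt_succ_self J)]
        simp
      rw [key, ← e1]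
      simp only [d', add_mul, Finset.sum_add_distrib]
      congr 1
      rw [Finset.sum_range_succ' _ (J + 1)]
      simp

theorem exists_sum_iterate_smul_euler_eq (D : R⟦X⟧) (J : ℕ) (c : ℕ → R⟦X⟧) :
    ∃ c' : ℕ → R⟦X⟧, c' J = c J * D ^ J ∧
      ∀ f, ∑ j ∈ Finset.range (J + 1), c j * (D • euler R)^[j] f =
        ∑ k ∈ Finset.range (J + 1), c' k * (euler R)^[k] f := by
  choose d h1 h2 h3 using exists_iterate_smul_euler_eq D
  refine ⟨fun k => ∑ j ∈ Finset.range (J + 1), c j * d j k, ?_, fun f => ?_⟩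
  · change ∑ j ∈ Finset.range (J + 1), c j * d j J = _
    rw [Finset.sum_eq_single J]
    · rw [h1]
    · intro j hj hne
      rw [h2 j J (by rw [Finset.mem_range] at hj; omega), mul_zero]
    · simp
  · simp only [Finset.sum_mul]
    rw [Finset.sum_comm]
    refine Finset.sum_congr rfl fun j hj => ?_
    rw [h3, Finset.mul_sum]
    rw [Finset.mem_range] at hj
    refine Finset.sum_subset_zero_on_sdiff (Finset.range_mono (by omega)) ?_ ?_
    · intro k hk
      rw [Finset.mem_sdiff, Finset.mem_range, Finset.mem_range] at hk
      rw [h2 j k (by omega)]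
      ring
    · intro k _
      ring

/-- With `s` the least order of the `c j`, the coefficient of `X ^ (N + s)` in the sum is `I(N)`
times the leading coefficient of `f`, where `I` is the nonzero indicial polynomial. In a domain of
characteristic zero, `I` does not vanish at large integers `N`. -/
theorem exists_order_bound_of_ne_zero [IsDomain R] [CharZero R] (J : ℕ) (c : ℕ → R⟦X⟧)
    (hc : c J ≠ 0) :
    ∃ s k₀ : ℕ, ∀ (N r : ℕ) (f : R⟦X⟧), k₀ ≤ N → X ^ N ∣ f → ¬ X ^ (N + 1) ∣ f →
      X ^ r ∣ ∑ j ∈ Finset.range (J + 1), c j * (euler R)^[j] f → r ≤ N + s := by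
  classical
  have hex : ∃ s, ∃ j ∈ Finset.range (J + 1), coeff s (c j) ≠ 0 := by
    by_contra! h
    exact hc (PowerSeries.ext fun s => by simpa using h s J (by simp))
  set s := Nat.find hex with hs
  obtain ⟨j₀, hj₀, hne⟩ := Nat.find_spec hex
  have hdvd : ∀ j ∈ Finset.range (J + 1), X ^ s ∣ c j := by
    intro j hj
    rw [X_pow_dvd_iff]
    intro t ht
    have := Nat.find_min hex ht
    push Not at this
    exact this j hj
  -- The indicial polynomial; it arises because `euler` acts on `X ^ N` as multiplication by `N`.
  let I : Polynomial R := ∑ j ∈ Finset.range (J + 1), Polynomial.monomial j (coeff s (c j))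
  have hI : I ≠ 0 := by
    intro h0
    apply hne
    have h1 : I.coeff j₀ = coeff s (c j₀) := by
      simp only [I, Polynomial.finsetSum_coeff, Polynomial.coeff_monomial]
      rw [Finset.sum_ite_eq' _ j₀, if_pos hj₀]
    rw [← h1, h0, Polynomial.coeff_zero]
  have hfin : {N : ℕ | I.eval (N : R) = 0}.Finite := by
    have : {N : ℕ | I.eval (N : R) = 0} = (Nat.cast : ℕ → R) ⁻¹' {x | I.IsRoot x} := rfl
    rw [this]
    exact (Polynomial.finite_setOfPred_isRoot hI).preimage Nat.cast_injective.injOn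
  obtain ⟨B, hB⟩ := hfin.bddAbove
  refine ⟨s, B + 1, fun N r f hN hf hf' hr => ?_⟩
  by_contra! hlt
  have hzero := X_pow_dvd_iff.1 hr (N + s) hlt
  have hfN : coeff N f ≠ 0 := by
    intro h0
    apply hf'
    rw [X_pow_dvd_iff] at hf ⊢
    intro t ht
    rcases Nat.lt_succ_iff_lt_or_eq.1 ht with h | rfl
    · exact hf t h
    · exact h0
  have hev : I.eval (N : R) ≠ 0 := fun h => by
    have := hB (show N ∈ {N : ℕ | I.eval (N : R) = 0} from h)
    omega
  apply mul_ne_zero hev hfN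
  rw [← hzero, map_sum, Polynomial.eval_finsetSum, Finset.sum_mul]
  refine Finset.sum_congr rfl fun j hj => ?_
  obtain ⟨a, ha⟩ := hdvd j hj
  obtain ⟨b, hb⟩ := X_pow_dvd_euler_iterate hf j
  have h1 : coeff s (c j) = constantCoeff a := by
    rw [ha]; simpa using coeff_X_pow_mul a s 0
  have h2 : (N : R) ^ j * coeff N f = constantCoeff b := by
    rw [← coeff_euler_iterate, hb]; simpa using coeff_X_pow_mul b N 0
  have h3 : coeff (N + s) (c j * (euler R)^[j] f) = constantCoeff (a * b) := by
    rw [ha, hb, show X ^ s * a * (X ^ N * b) = X ^ (N + s) * (a * b) by ring]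
    simpa using coeff_X_pow_mul (a * b) (N + s) 0
  rw [h3, map_mul, ← h1, ← h2, Polynomial.eval_monomial]
  ring

/-- Rows obtained from `e i` by repeatedly differentiating along the system `D • euler u = M u`. -/
noncomputable def derivedRow {n : ℕ} (D : R⟦X⟧) (M : Fin n → Fin n → R⟦X⟧) (i : Fin n) :
    ℕ → Fin n → R⟦X⟧
  | 0 => Pi.single i 1
  | j + 1 => fun l => D * euler R (derivedRow D M i j l) + ∑ k, derivedRow D M i j k * M k l

/-- The Euler derivation does not lower the order in `X`, so differentiating the approximate system
loses no accuracy. -/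
theorem X_pow_dvd_iterate_sub_derivedRow {n : ℕ} (D : R⟦X⟧) (M : Fin n → Fin n → R⟦X⟧)
    (i : Fin n) (u : Fin n → R⟦X⟧) (r : ℕ)
    (h : ∀ k, X ^ r ∣ D * euler R (u k) - ∑ l, M k l * u l) (j : ℕ) :
    X ^ r ∣ (D • euler R)^[j] (u i) - ∑ l, derivedRow D M i j l * u l := by
  induction j with
  | zero => simp [derivedRow, Pi.single_apply]
  | succ j ih =>
    rw [Function.iterate_succ_apply']
    have h1 : X ^ r ∣ (D • euler R)
        ((D • euler R)^[j] (u i) - ∑ l, derivedRow D M i j l * u l) :=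
      (X_pow_dvd_euler ih).mul_left D
    have h2 : X ^ r ∣ ∑ k, derivedRow D M i j k * (D * euler R (u k) - ∑ l, M k l * u l) :=
      Finset.dvd_sum fun k _ => (h k).mul_left _
    convert dvd_add h1 h2 using 1
    have h3 : (D • euler R) (∑ l, derivedRow D M i j l * u l) =
        ∑ l, D * euler R (derivedRow D M i j l) * u l +
          ∑ l, derivedRow D M i j l * (D * euler R (u l)) := by
      rw [map_sum, ← Finset.sum_add_distrib]
      refine Finset.sum_congr rfl fun l _ => ?_
      simp only [Derivation.smul_apply, Derivation.leibniz, smul_eq_mul]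
      ring
    have h4 : ∑ k, derivedRow D M i j k * ∑ l, M k l * u l =
        ∑ l, (∑ k, derivedRow D M i j k * M k l) * u l := by
      simp only [Finset.mul_sum, Finset.sum_mul]
      rw [Finset.sum_comm]
      exact Finset.sum_congr rfl fun _ _ => Finset.sum_congr rfl fun _ _ => by ring
    rw [map_sub, h3]
    simp only [derivedRow, mul_sub, add_mul, Finset.sum_sub_distrib, Finset.sum_add_distrib, h4]
    ring

/-- Elimination: `n + 1` derived rows in a free module of rank `n` are dependent, and a dependence
relation is a scalar equation for `u i` modulo `X ^ r`. -/
theorem exists_order_bound_component [IsDomain R] [CharZero R] {n : ℕ} (D : R⟦X⟧) (hD : D ≠ 0)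
    (M : Fin n → Fin n → R⟦X⟧) (i : Fin n) :
    ∃ s k₀ : ℕ, ∀ (N r : ℕ) (u : Fin n → R⟦X⟧), k₀ ≤ N → X ^ N ∣ u i → ¬ X ^ (N + 1) ∣ u i →
      (∀ k, X ^ r ∣ D * euler R (u k) - ∑ l, M k l * u l) → r ≤ N + s := by
  classical
  have hdep : ¬ LinearIndependent R⟦X⟧ (fun j : Fin (n + 1) => derivedRow D M i j) := by
    intro h
    simpa using h.fintype_card_le_finrank
  obtain ⟨c, hc, j₁, hj₁⟩ := Fintype.not_linearIndependent_iff.1 hdep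
  let c₁ : ℕ → R⟦X⟧ := fun j => if h : j < n + 1 then c ⟨j, h⟩ else 0
  have hc₁ : ∑ j ∈ Finset.range (n + 1), c₁ j • derivedRow D M i j = 0 := by
    rw [Finset.sum_range, ← hc]
    exact Finset.sum_congr rfl fun j _ => by simp only [c₁, dif_pos j.2]
  -- the highest index with a nonzero coefficient
  let T := (Finset.range (n + 1)).filter fun j => c₁ j ≠ 0
  have hT : T.Nonempty := ⟨j₁, by simp [T, c₁, hj₁, Nat.le_of_lt_succ j₁.2]⟩
  set J := T.max' hT
  have hJ : J ∈ T := T.max'_mem hT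
  have hJ' : J < n + 1 ∧ c₁ J ≠ 0 := by simpa [T] using hJ
  have hsum : ∑ j ∈ Finset.range (J + 1), c₁ j • derivedRow D M i j = 0 := by
    rw [← hc₁]
    refine Finset.sum_subset (Finset.range_mono (by omega)) fun j hj hj' => ?_
    have : c₁ j = 0 := by
      by_contra hne
      have := T.le_max' j (by simp only [T, Finset.mem_filter]; exact ⟨hj, hne⟩)
      rw [Finset.mem_range] at hj'
      omega
    rw [this, zero_smul]
  obtain ⟨c', hc'J, hc'⟩ := exists_sum_iterate_smul_euler_eq D J c₁
  obtain ⟨s, k₀, hbound⟩ := exists_order_bound_of_ne_zero J c'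
    (by rw [hc'J]; exact mul_ne_zero hJ'.2 (pow_ne_zero _ hD))
  refine ⟨s, k₀, fun N r u hN h1 h2 h3 => hbound N r (u i) hN h1 h2 ?_⟩
  rw [← hc']
  have : ∑ j ∈ Finset.range (J + 1), c₁ j * (D • euler R)^[j] (u i) =
      ∑ j ∈ Finset.range (J + 1), c₁ j *
        ((D • euler R)^[j] (u i) - ∑ l, derivedRow D M i j l * u l) := by
    have h0 : ∑ j ∈ Finset.range (J + 1), c₁ j * ∑ l, derivedRow D M i j l * u l = 0 := by
      simp only [Finset.mul_sum]
      rw [Finset.sum_comm]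
      refine Finset.sum_eq_zero fun l _ => ?_
      have := congrFun hsum l
      simp only [Finset.sum_apply, Pi.smul_apply, smul_eq_mul, Pi.zero_apply] at this
      simp only [← mul_assoc, ← Finset.sum_mul, this, zero_mul]
    simp only [mul_sub, Finset.sum_sub_distrib, h0, sub_zero]
  rw [this]
  exact Finset.dvd_sum fun j _ => (X_pow_dvd_iterate_sub_derivedRow D M i u r h3 j).mul_left _

/-- A first-order linear system `D • euler u = M u` with `D ≠ 0` raises the order of a vector of
power series of large order by at most a fixed amount. -/
theorem exists_order_bound [IsDomain R] [CharZero R] {n : ℕ} (D : R⟦X⟧) (hD : D ≠ 0)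
    (M : Fin n → Fin n → R⟦X⟧) :
    ∃ K : ℕ, ∀ (N r : ℕ) (u : Fin n → R⟦X⟧), K ≤ N → (∃ i, X ^ N ∣ u i ∧ ¬ X ^ (N + 1) ∣ u i) →
      (∀ k, X ^ r ∣ D * euler R (u k) - ∑ l, M k l * u l) → r ≤ N + K := by
  choose s k₀ h using exists_order_bound_component D hD M
  -- One constant that is both above every threshold `k₀ i` and above every shift `s i`.
  refine ⟨Finset.univ.sup s + Finset.univ.sup k₀, ?_⟩
  rintro N r u hN ⟨i, h1, h2⟩ h3
  have hs : s i ≤ Finset.univ.sup s := Finset.le_sup (Finset.mem_univ i)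
  have hk : k₀ i ≤ Finset.univ.sup k₀ := Finset.le_sup (Finset.mem_univ i)
  have := h i N r u (by omega) h1 h2 h3
  omega

end Euler

end PowerSeries

/-! ### Analytic germs and Taylor expansion in the first variable. -/

section AnalyticGerm

open scoped Nat

variable (E : Type*) [NormedAddCommGroup E] [NormedSpace ℝ E]

/-- The ring of real functions that are analytic at the origin. -/
def analyticSubring : Subring (E → ℝ) where
  carrier := {f | AnalyticAt ℝ f 0}
  mul_mem' hf hg := hf.mul hg
  one_mem' := analyticAt_const
  add_mem' hf hg := hf.add hg
  zero_mem' := analyticAt_const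
  neg_mem' hf := hf.neg

/-- The ring homomorphism that sends an analytic function to its germ at the origin. -/
def analyticToGerm : analyticSubring E →+* Germ (𝓝 (0 : E)) ℝ :=
  (Germ.coeRingHom _).comp (analyticSubring E).subtype

/-- The ring of germs at the origin of real-analytic functions. -/
abbrev AnalyticGerm : Type _ := (analyticToGerm E).range

variable {E}

/-- The germ of an analytic function. -/
def analyticGerm : analyticSubring E →+* AnalyticGerm E := (analyticToGerm E).rangeRestrict

theorem analyticGerm_surjective : Function.Surjective (analyticGerm (E := E)) :=
  (analyticToGerm E).rangeRestrict_surjective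

theorem analyticGerm_eq_iff {f g : analyticSubring E} :
    analyticGerm f = analyticGerm g ↔ f.1 =ᶠ[𝓝 0] g.1 :=
  Subtype.ext_iff.trans Germ.coe_eq

theorem analyticGerm_eq_zero_iff {f : analyticSubring E} :
    analyticGerm f = 0 ↔ ∀ᶠ θ in 𝓝 0, f.1 θ = 0 := by
  rw [← map_zero analyticGerm, analyticGerm_eq_iff]
  rfl

/-- If `g` is nonzero at some point near `0`, then `f` vanishes around that point, hence on a whole
ball by the identity theorem. -/
instance : NoZeroDivisors (AnalyticGerm E) where
  eq_zero_or_eq_zero_of_mul_eq_zero := by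
    intro a b hab
    obtain ⟨f, rfl⟩ := analyticGerm_surjective a
    obtain ⟨g, rfl⟩ := analyticGerm_surjective b
    rw [← map_mul] at hab
    rw [analyticGerm_eq_zero_iff] at hab ⊢
    rw [analyticGerm_eq_zero_iff, or_iff_not_imp_right]
    intro hg
    obtain ⟨r₁, hr₁, hf₁⟩ := AnalyticAt.exists_ball_analyticOnNhd f.2
    obtain ⟨r₂, hr₂, hg₁⟩ := AnalyticAt.exists_ball_analyticOnNhd g.2
    obtain ⟨r₃, hr₃, hfg⟩ := Metric.eventually_nhds_iff_ball.1 hab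
    set r := min r₁ (min r₂ r₃)
    have hr : 0 < r := lt_min hr₁ (lt_min hr₂ hr₃)
    obtain ⟨θ, hθ, hgθ⟩ : ∃ θ ∈ Metric.ball (0 : E) r, g.1 θ ≠ 0 := by
      by_contra! h
      exact hg (Metric.eventually_nhds_iff_ball.2 ⟨r, hr, h⟩)
    have hθ₁ := Metric.ball_subset_ball (min_le_left r₁ _) hθ
    have hθ₂ := Metric.ball_subset_ball ((min_le_right r₁ _).trans (min_le_left _ _)) hθ
    have hnear : f.1 =ᶠ[𝓝 θ] 0 := by
      filter_upwards [(hg₁ θ hθ₂).continuousAt.eventually_ne hgθ, Metric.isOpen_ball.mem_nhds hθ]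
        with t ht ht'
      exact (mul_eq_zero.1 (hfg t (Metric.ball_subset_ball
        ((min_le_right r₁ _).trans (min_le_right _ _)) ht'))).resolve_right ht
    have := hf₁.eqOn_zero_of_preconnected_of_eventuallyEq_zero
      (convex_ball _ _).isPreconnected hθ₁ hnear
    exact Metric.eventually_nhds_iff_ball.2 ⟨r₁, hr₁, this⟩

instance : CharZero (AnalyticGerm E) where
  cast_injective := by
    intro a b hab
    have h : analyticGerm (E := E) a = analyticGerm (E := E) b := by simpa using hab
    have h0 : ((a : ℕ) : ℝ) = (b : ℕ) := (analyticGerm_eq_iff.1 h).self_of_nhds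
    exact_mod_cast h0

instance : IsDomain (AnalyticGerm E) := NoZeroDivisors.to_isDomain _

theorem analyticAt_deriv_fst {F : Type*} [NormedAddCommGroup F] [NormedSpace ℝ F]
    [CompleteSpace F] {f : ℝ × E → F} {z : ℝ × E} (hf : AnalyticAt ℝ f z) :
    AnalyticAt ℝ (fun z => deriv (fun x => f (x, z.2)) z.1) z := by
  have h : AnalyticAt ℝ (fun z => fderiv ℝ f z (1, 0)) z :=
    ((ContinuousLinearMap.apply ℝ F ((1 : ℝ), (0 : E))).analyticAt _).comp hf.fderiv
  refine h.congr ?_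
  filter_upwards [hf.eventually_analyticAt] with w hw
  have h1 : HasDerivAt (fun x : ℝ => (x, w.2)) ((1 : ℝ), (0 : E)) w.1 :=
    (hasDerivAt_id w.1).prodMk (hasDerivAt_const _ _)
  exact (HasFDerivAt.comp_hasDerivAt w.1 (hw.differentiableAt.hasFDerivAt : _) h1).deriv.symm

theorem analyticAt_iteratedDeriv_fst {F : Type*} [NormedAddCommGroup F] [NormedSpace ℝ F]
    [CompleteSpace F] {f : ℝ × E → F} {z : ℝ × E} (hf : AnalyticAt ℝ f z) (l : ℕ) :
    AnalyticAt ℝ (fun z => iteratedDeriv l (fun x => f (x, z.2)) z.1) z := by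
  induction l with
  | zero => simpa using hf
  | succ l ih =>
    simp only [iteratedDeriv_succ]
    exact analyticAt_deriv_fst ih

theorem analyticAt_iteratedDeriv_slice {F : Type*} [NormedAddCommGroup F] [NormedSpace ℝ F]
    [CompleteSpace F] {f : ℝ × E → F} {θ : E} (hf : AnalyticAt ℝ f (0, θ)) (l : ℕ) :
    AnalyticAt ℝ (fun θ => iteratedDeriv l (fun x => f (x, θ)) 0) θ :=
  (analyticAt_iteratedDeriv_fst hf l).comp_of_eq
    (f := fun θ : E => ((0 : ℝ), θ)) (by fun_prop) rfl

theorem AnalyticAt.slice {F : Type*} [NormedAddCommGroup F] [NormedSpace ℝ F]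
    {f : ℝ × E → F} {z : ℝ × E} (hf : AnalyticAt ℝ f z) :
    AnalyticAt ℝ (fun x => f (x, z.2)) z.1 :=
  hf.comp_of_eq (f := fun x : ℝ => (x, z.2)) (by fun_prop) rfl

theorem AnalyticAt.eventually_slice {F : Type*} [NormedAddCommGroup F] [NormedSpace ℝ F]
    [CompleteSpace F] {f : ℝ × E → F} (hf : AnalyticAt ℝ f 0) :
    ∀ᶠ θ : E in 𝓝 0, AnalyticAt ℝ (fun x => f (x, θ)) 0 := by
  have h : Tendsto (fun θ : E => ((0 : ℝ), θ)) (𝓝 0) (𝓝 0) :=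
    (by fun_prop : Continuous fun θ : E => ((0 : ℝ), θ)).tendsto' _ _ rfl
  filter_upwards [h.eventually hf.eventually_analyticAt] with θ hθ using hθ.slice

/-- The `l`-th Taylor coefficient in the first variable, a function of the second one. -/
noncomputable def sliceCoeff (f : analyticSubring (ℝ × E)) (l : ℕ) : analyticSubring E :=
  ⟨fun θ => (l ! : ℝ)⁻¹ * iteratedDeriv l (fun x => f.1 (x, θ)) 0,
    analyticAt_const.mul (analyticAt_iteratedDeriv_slice f.2 l)⟩

/-- The Taylor expansion of an analytic function in the first variable. -/
noncomputable def sliceTaylor : analyticSubring (ℝ × E) →+* PowerSeries (AnalyticGerm E) where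
  toFun f := PowerSeries.mk fun l => analyticGerm (sliceCoeff f l)
  map_zero' := by
    ext1 l
    rw [PowerSeries.coeff_mk, map_zero, analyticGerm_eq_zero_iff]
    refine Eventually.of_forall fun θ => ?_
    simp [sliceCoeff, iteratedDeriv_fun_const_zero]
  map_one' := by
    ext1 l
    rw [PowerSeries.coeff_mk, PowerSeries.coeff_one]
    split_ifs with h
    · rw [← map_one analyticGerm, analyticGerm_eq_iff]
      refine Eventually.of_forall fun θ => ?_
      simp [sliceCoeff, h]
    · rw [analyticGerm_eq_zero_iff]
      refine Eventually.of_forall fun θ => ?_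
      simp [sliceCoeff, iteratedDeriv_const, h]
  map_add' f g := by
    ext1 l
    rw [map_add, PowerSeries.coeff_mk, PowerSeries.coeff_mk, PowerSeries.coeff_mk, ← map_add,
      analyticGerm_eq_iff]
    filter_upwards [AnalyticAt.eventually_slice f.2, AnalyticAt.eventually_slice g.2] with θ hf hg
    have := iteratedDeriv_fun_add (n := l) hf.contDiffAt hg.contDiffAt
    simp only [sliceCoeff, Subring.coe_add, Pi.add_apply, this]
    ring
  map_mul' f g := by
    ext1 l
    simp only [PowerSeries.coeff_mul, PowerSeries.coeff_mk, ← map_mul, ← map_sum]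
    rw [analyticGerm_eq_iff]
    filter_upwards [AnalyticAt.eventually_slice f.2, AnalyticAt.eventually_slice g.2] with θ hf hg
    have := iteratedDeriv_fun_mul (n := l) hf.contDiffAt hg.contDiffAt
    simp only [sliceCoeff, Subring.coe_mul, Pi.mul_apply, this, AddSubmonoidClass.coe_finsetSum,
      Finset.sum_apply]
    rw [Finset.Nat.sum_antidiagonal_eq_sum_range_succ_mk, Finset.mul_sum]
    refine Finset.sum_congr rfl fun i hi ↦ ?_
    rw [Nat.cast_choose _ (by grind)]
    field_simp [Nat.factorial_ne_zero]

theorem coeff_sliceTaylor (f : analyticSubring (ℝ × E)) (l : ℕ) :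
    PowerSeries.coeff l (sliceTaylor f) = analyticGerm (sliceCoeff f l) :=
  PowerSeries.coeff_mk l fun l => analyticGerm (sliceCoeff f l)

theorem coeff_sliceTaylor_eq_zero_iff {f : analyticSubring (ℝ × E)} {l : ℕ} :
    PowerSeries.coeff l (sliceTaylor f) = 0 ↔
      ∀ᶠ θ : E in 𝓝 0, iteratedDeriv l (fun x => f.1 (x, θ)) 0 = 0 := by
  rw [coeff_sliceTaylor, analyticGerm_eq_zero_iff]
  simp [sliceCoeff, Nat.factorial_ne_zero]

theorem sliceTaylor_congr {f g : analyticSubring (ℝ × E)} (h : f.1 =ᶠ[𝓝 0] g.1) :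
    sliceTaylor f = sliceTaylor g := by
  have hθ : Tendsto (fun θ : E => ((0 : ℝ), θ)) (𝓝 0) (𝓝 0) :=
    (by fun_prop : Continuous fun θ : E => ((0 : ℝ), θ)).tendsto' _ _ rfl
  ext1 l
  rw [coeff_sliceTaylor, coeff_sliceTaylor, analyticGerm_eq_iff]
  filter_upwards [hθ.eventually (Eventually.eventually_nhds h)] with θ h
  have hx : Tendsto (fun x : ℝ => (x, θ)) (𝓝 0) (𝓝 (0, θ)) :=
    (by fun_prop : Continuous fun x : ℝ => (x, θ)).tendsto' _ _ rfl
  have h1 : (fun x => f.1 (x, θ)) =ᶠ[𝓝 0] fun x => g.1 (x, θ) := hx.eventually h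
  simp only [sliceCoeff, h1.iteratedDeriv_eq l]

/-- Divisibility by a power of `X` of the Taylor expansion is a pointwise growth condition. -/
theorem X_pow_dvd_sliceTaylor_iff {f : analyticSubring (ℝ × E)} {N : ℕ} :
    PowerSeries.X ^ N ∣ sliceTaylor f ↔
      ∀ᶠ θ : E in 𝓝 0, (fun x => f.1 (x, θ)) =O[𝓝 0] fun x : ℝ => x ^ N := by
  rw [PowerSeries.X_pow_dvd_iff]
  simp only [coeff_sliceTaylor_eq_zero_iff]
  -- Only finitely many coefficients are involved, so one neighbourhood of `θ = 0` serves them all.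
  have hfin : (∀ l < N, ∀ᶠ θ : E in 𝓝 0, iteratedDeriv l (fun x => f.1 (x, θ)) 0 = 0) ↔
      ∀ᶠ θ : E in 𝓝 0, ∀ l < N, iteratedDeriv l (fun x => f.1 (x, θ)) 0 = 0 :=
    ((Set.finite_lt_nat N).eventually_all (l := 𝓝 (0 : E))
      (p := fun l θ => iteratedDeriv l (fun x => f.1 (x, θ)) 0 = 0)).symm
  rw [hfin]
  refine eventually_congr ?_
  filter_upwards [AnalyticAt.eventually_slice f.2] with θ hθ
  rw [← natCast_le_analyticOrderAt_iff_iteratedDeriv_eq_zero hθ]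
  constructor
  · intro h
    obtain ⟨g, hg, hfg⟩ := (natCast_le_analyticOrderAt hθ).1 h
    refine (Asymptotics.IsBigO.congr' (f₁ := fun x => x ^ N * g x) (g₁ := fun x => x ^ N * 1)
      ((Asymptotics.isBigO_refl _ _).mul ?_) ?_ ?_)
    · exact hg.continuousAt.norm.isBoundedUnder_le.isBigO_one ℝ
    · filter_upwards [hfg] with x hx
      rw [hx]; simp
    · exact Eventually.of_forall fun x => mul_one _
  · intro h
    by_contra! hlt
    obtain ⟨k, hk⟩ := ENat.ne_top_iff_exists.1 (ne_top_of_lt hlt)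
    obtain ⟨g, hg, hg0, hfg⟩ := hθ.analyticOrderAt_eq_natCast.1 hk.symm
    rw [← hk] at hlt
    have hkN : k < N := by exact_mod_cast hlt
    have h1 : (fun x : ℝ => x ^ k * g x) =O[𝓝[≠] 0] fun x : ℝ => x ^ k * x ^ (N - k) := by
      refine ((h.mono nhdsWithin_le_nhds).congr' ?_ ?_)
      · filter_upwards [nhdsWithin_le_nhds hfg] with x hx
        rw [hx]; simp
      · exact Eventually.of_forall fun x => by
          simp only [← pow_add]; congr 1; omega
    have h2 : g =O[𝓝[≠] 0] fun x : ℝ => x ^ (N - k) := by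
      have h3 := (Asymptotics.isBigO_refl (fun x : ℝ => (x ^ k)⁻¹) (𝓝[≠] 0)).mul h1
      refine h3.congr' ?_ ?_
      all_goals
        filter_upwards [self_mem_nhdsWithin] with x hx
        exact inv_mul_cancel_left₀ (pow_ne_zero _ hx) _
    have h4 : Tendsto (fun x : ℝ => x ^ (N - k)) (𝓝[≠] 0) (𝓝 0) := by
      have : Tendsto (fun x : ℝ => x ^ (N - k)) (𝓝 0) (𝓝 0) :=
        (by fun_prop : Continuous fun x : ℝ => x ^ (N - k)).tendsto' _ _
          (zero_pow (by omega))
      exact this.mono_left nhdsWithin_le_nhds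
    exact hg0 (tendsto_nhds_unique (hg.continuousAt.tendsto.mono_left nhdsWithin_le_nhds)
      (h2.trans_tendsto h4))

/-- The neighbourhoods on which the individual coefficients vanish could shrink with `l`. The
identity theorem in `θ` extends the vanishing to a common ball; the identity theorem in `x` then
finishes each slice. -/
theorem eventually_eq_zero_of_sliceTaylor_eq_zero {f : analyticSubring (ℝ × E)}
    (h : sliceTaylor f = 0) : ∀ᶠ z in 𝓝 0, f.1 z = 0 := by
  obtain ⟨r, hr, hf⟩ := AnalyticAt.exists_ball_analyticOnNhd f.2
  refine Metric.eventually_nhds_iff_ball.2 ⟨r, hr, fun z hz => ?_⟩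
  have hprod : Metric.ball (0 : ℝ × E) r = Metric.ball (0 : ℝ) r ×ˢ Metric.ball (0 : E) r :=
    (ball_prod_same _ _ _).symm
  rw [hprod] at hz hf
  have hx0 : (0 : ℝ) ∈ Metric.ball (0 : ℝ) r := Metric.mem_ball_self hr
  have hder : ∀ l, iteratedDeriv l (fun x => f.1 (x, z.2)) 0 = 0 := by
    intro l
    have h0 : ∀ᶠ θ : E in 𝓝 0, iteratedDeriv l (fun x => f.1 (x, θ)) 0 = 0 :=
      coeff_sliceTaylor_eq_zero_iff.1 (by rw [h, map_zero])
    have han : AnalyticOnNhd ℝ (fun θ => iteratedDeriv l (fun x => f.1 (x, θ)) 0)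
        (Metric.ball (0 : E) r) :=
      fun θ hθ => analyticAt_iteratedDeriv_slice (hf (0, θ) ⟨hx0, hθ⟩) l
    exact han.eqOn_zero_of_preconnected_of_eventuallyEq_zero (convex_ball _ _).isPreconnected
      (Metric.mem_ball_self hr) h0 hz.2
  have hslice : AnalyticOnNhd ℝ (fun x => f.1 (x, z.2)) (Metric.ball (0 : ℝ) r) :=
    fun x hx => (hf (x, z.2) ⟨hx, hz.2⟩).slice
  have hzero : (fun x => f.1 (x, z.2)) =ᶠ[𝓝 0] 0 := by
    refine analyticOrderAt_eq_top.1 ?_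
    refine ENat.eq_top_iff_forall_ge.2 fun N => ?_
    exact (natCast_le_analyticOrderAt_iff_iteratedDeriv_eq_zero (hslice 0 hx0)).2
      fun i _ => hder i
  exact hslice.eqOn_zero_of_preconnected_of_eventuallyEq_zero (convex_ball _ _).isPreconnected
    hx0 hzero hz.1

/-- The first coordinate as an analytic function. -/
def analyticFst : analyticSubring (ℝ × E) := ⟨Prod.fst, analyticAt_fst⟩

theorem sliceTaylor_analyticFst : sliceTaylor (analyticFst (E := E)) = PowerSeries.X := by
  ext1 l
  rw [coeff_sliceTaylor, PowerSeries.coeff_X]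
  split_ifs with h
  · rw [← map_one analyticGerm, analyticGerm_eq_iff]
    refine Eventually.of_forall fun θ => ?_
    simp [sliceCoeff, analyticFst, h]
  · rw [analyticGerm_eq_zero_iff]
    refine Eventually.of_forall fun θ => ?_
    simp [sliceCoeff, analyticFst, iteratedDeriv_fun_id_zero, h]

/-- The partial derivative with respect to the first variable. -/
noncomputable def derivFst (f : analyticSubring (ℝ × E)) : analyticSubring (ℝ × E) :=
  ⟨fun z => deriv (fun x => f.1 (x, z.2)) z.1, analyticAt_deriv_fst f.2⟩

theorem sliceTaylor_derivFst (f : analyticSubring (ℝ × E)) :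
    sliceTaylor (derivFst f) = PowerSeries.derivative _ (sliceTaylor f) := by
  ext1 l
  rw [PowerSeries.coeff_derivative, coeff_sliceTaylor, coeff_sliceTaylor]
  have : (l + 1 : AnalyticGerm E) = analyticGerm (l + 1 : analyticSubring E) := by simp
  rw [this, ← map_mul, analyticGerm_eq_iff]
  refine Eventually.of_forall fun θ => ?_
  have h1 : ((l + 1 : analyticSubring E) : E → ℝ) θ = l + 1 := by simp
  simp only [sliceCoeff, derivFst, Subring.coe_mul, Pi.mul_apply, h1, iteratedDeriv_succ',
    Nat.factorial_succ]
  push_cast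
  field_simp

end AnalyticGerm

/-- Mean value inequality on a segment, with `fderiv` locally Lipschitz; the constant is uniform in
both endpoints. -/
theorem AnalyticAt.exists_norm_sub_sub_fderiv_le {V W : Type*} [NormedAddCommGroup V]
    [NormedSpace ℝ V] [NormedAddCommGroup W] [NormedSpace ℝ W] [CompleteSpace W]
    {F : V → W} {v : V} (hF : AnalyticAt ℝ F v) :
    ∃ C : ℝ, ∀ᶠ ab : V × V in 𝓝 (v, v),
      ‖F ab.2 - F ab.1 - fderiv ℝ F ab.1 (ab.2 - ab.1)‖ ≤ C * ‖ab.2 - ab.1‖ ^ 2 := by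
  obtain ⟨K, t, ht, hlip⟩ := (hF.fderiv.contDiffAt (n := 1)).exists_lipschitzOnWith
  obtain ⟨r, hr, h⟩ := Metric.eventually_nhds_iff_ball.1
    (hF.eventually_analyticAt.and (eventually_mem_set.2 ht))
  refine ⟨K, ?_⟩
  filter_upwards [prod_mem_nhds (Metric.ball_mem_nhds v hr) (Metric.ball_mem_nhds v hr)]
  rintro ⟨a, b⟩ ⟨ha, hb⟩
  have hseg : segment ℝ a b ⊆ Metric.ball v r := (convex_ball v r).segment_subset ha hb
  have := (convex_segment a b).norm_image_sub_le_of_norm_fderiv_le' (𝕜 := ℝ) (f := F)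
    (φ := fderiv ℝ F a) (C := K * ‖b - a‖) (fun x hx => (h x (hseg hx)).1.differentiableAt)
    (fun x hx => ?_) (left_mem_segment ℝ a b) (right_mem_segment ℝ a b)
  · calc _ ≤ _ := this
      _ = _ := by ring
  · have h1 := hlip.dist_le_mul x (h x (hseg hx)).2 a (h a ha).2
    rw [dist_eq_norm, dist_eq_norm] at h1
    refine h1.trans (mul_le_mul_of_nonneg_left ?_ K.2)
    exact norm_sub_le_of_mem_segment hx

theorem Filter.Eventually.eventually_slice {E : Type*} [TopologicalSpace E] [Zero E]
    {P : ℝ × E → Prop} (h : ∀ᶠ z in 𝓝 (0 : ℝ × E), P z) :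
    ∀ᶠ θ : E in 𝓝 0, ∀ᶠ x : ℝ in 𝓝 0, P (x, θ) := by
  have h₁ : Tendsto (fun θ : E => ((0 : ℝ), θ)) (𝓝 0) (𝓝 0) :=
    (by fun_prop : Continuous fun θ : E => ((0 : ℝ), θ)).tendsto' _ _ rfl
  filter_upwards [h₁.eventually h.eventually_nhds] with θ hθ
  exact ((by fun_prop : Continuous fun x : ℝ => (x, θ)).tendsto' 0 (0, θ) rfl).eventually hθ

/-! ### Components of vector-valued functions. -/

section Slice

variable {E : Type*} [NormedAddCommGroup E] [NormedSpace ℝ E] {n : ℕ}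

theorem sliceTaylor_ne_zero {f : analyticSubring (ℝ × E)}
    (h : ¬ ∀ᶠ θ : E in 𝓝 0, f.1 (0, θ) = 0) : sliceTaylor f ≠ 0 := by
  intro h0
  have := (coeff_sliceTaylor_eq_zero_iff (f := f) (l := 0)).1 (by rw [h0, map_zero])
  exact h (by simpa using this)

/-- The components of a vector-valued analytic function. -/
def analyticComponent (y : ℝ × E → Fin n → ℝ) (hy : AnalyticAt ℝ y 0) (i : Fin n) :
    analyticSubring (ℝ × E) :=
  ⟨fun z => y z i, analyticAt_pi_iff.1 hy i⟩

theorem iteratedDeriv_apply {f : ℝ → Fin n → ℝ} {x : ℝ} (hf : AnalyticAt ℝ f x) (l : ℕ)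
    (i : Fin n) : iteratedDeriv l (fun t => f t i) x = iteratedDeriv l f x i := by
  have := (ContinuousLinearMap.proj (R := ℝ) (φ := fun _ : Fin n => ℝ) i).iteratedFDeriv_comp_left
    (hf.contDiffAt (n := l)) (i := l) le_rfl
  exact congrArg (fun T => T fun _ => 1) this

theorem coeff_sliceTaylor_analyticComponent_sub {y y' : ℝ × E → Fin n → ℝ}
    (hy : AnalyticAt ℝ y 0) (hy' : AnalyticAt ℝ y' 0) (i : Fin n) (l : ℕ)
    (h : ∀ᶠ θ : E in 𝓝 0, iteratedDeriv l (fun x => y (x, θ)) 0 =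
      iteratedDeriv l (fun x => y' (x, θ)) 0) :
    PowerSeries.coeff l (sliceTaylor (analyticComponent y hy i - analyticComponent y' hy' i)) =
      0 := by
  rw [coeff_sliceTaylor_eq_zero_iff]
  filter_upwards [h, hy.eventually_slice, hy'.eventually_slice] with θ hθ h1 h2
  have e1 := iteratedDeriv_apply h1 l i
  have e2 := iteratedDeriv_apply h2 l i
  have h3 := iteratedDeriv_fun_sub (n := l) (analyticAt_pi_iff.1 h1 i).contDiffAt
    (analyticAt_pi_iff.1 h2 i).contDiffAt
  rw [e1, e2, hθ, sub_self] at h3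
  exact h3

theorem eventually_deriv_apply {y : ℝ × E → Fin n → ℝ} (hy : AnalyticAt ℝ y 0) :
    ∀ᶠ z : ℝ × E in 𝓝 0, ∀ i, deriv (fun x => y (x, z.2)) z.1 i =
      (derivFst (analyticComponent y hy i)).1 z := by
  filter_upwards [hy.eventually_analyticAt] with z hz i
  have := iteratedDeriv_apply hz.slice 1 i
  rw [iteratedDeriv_one, iteratedDeriv_one] at this
  exact this.symm

end Slice

/-! ### The equation cleared of its denominator. -/

section Residual

variable {n : ℕ} {V : Type*} [NormedAddCommGroup V] [NormedSpace ℝ V]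

/-- The residual `q w - p` of the equation `w = p / q` cleared of its denominator. -/
def clearedResidual (p : V → Fin n → ℝ) (q : V → ℝ) (v : V × (Fin n → ℝ)) : Fin n → ℝ :=
  q v.1 • v.2 - p v.1

theorem analyticAt_clearedResidual {p : V → Fin n → ℝ} {q : V → ℝ} {v : V × (Fin n → ℝ)}
    (hp : AnalyticAt ℝ p v.1) (hq : AnalyticAt ℝ q v.1) :
    AnalyticAt ℝ (clearedResidual p q) v :=
  ((hq.comp analyticAt_fst).smul analyticAt_snd).sub (hp.comp analyticAt_fst)

theorem fderiv_clearedResidual_snd {p : V → Fin n → ℝ} {q : V → ℝ} {v : V × (Fin n → ℝ)}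
    (hp : AnalyticAt ℝ p v.1) (hq : AnalyticAt ℝ q v.1) (w : Fin n → ℝ) :
    fderiv ℝ (clearedResidual p q) v (0, w) = q v.1 • w := by
  have hq' : HasFDerivAt (fun v : V × (Fin n → ℝ) => q v.1) _ v :=
    hq.differentiableAt.hasFDerivAt.comp v hasFDerivAt_fst
  have hp' : HasFDerivAt (fun v : V × (Fin n → ℝ) => p v.1) _ v :=
    hp.differentiableAt.hasFDerivAt.comp v hasFDerivAt_fst
  have h : HasFDerivAt (clearedResidual p q) _ v := (hq'.smul hasFDerivAt_snd).sub hp'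
  rw [h.fderiv]
  simp

end Residual

/-! ### Linearisation along a solution. -/

section Equation

variable {n m γ : ℕ} {p : ℝ × (Fin n → ℝ) × (Fin m → ℝ) → (Fin n → ℝ)}
  {q : ℝ × (Fin n → ℝ) × (Fin m → ℝ) → ℝ} {y : ℝ × (Fin m → ℝ) → (Fin n → ℝ)}

/-- The lift `(x, y, θ, x ^ (γ + 1) ∂ₓ y)` of a function `y(x, θ)`. -/
noncomputable def jetLift (γ : ℕ) (y : ℝ × (Fin m → ℝ) → (Fin n → ℝ)) (z : ℝ × (Fin m → ℝ)) :
    (ℝ × (Fin n → ℝ) × (Fin m → ℝ)) × (Fin n → ℝ) :=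
  ((z.1, y z, z.2), z.1 ^ (γ + 1) • deriv (fun x : ℝ => y (x, z.2)) z.1)

theorem analyticAt_jetLift (hy : AnalyticAt ℝ y 0) : AnalyticAt ℝ (jetLift γ y) 0 :=
  (analyticAt_fst.prod (hy.prod analyticAt_snd)).prod
    ((analyticAt_fst.pow _).smul (analyticAt_deriv_fst hy))

theorem analyticAt_jetLift_fst (hy : AnalyticAt ℝ y 0) :
    AnalyticAt ℝ (fun z => (jetLift γ y z).1) 0 :=
  analyticAt_fst.prod (hy.prod analyticAt_snd)

theorem jetLift_zero (hy0 : y 0 = 0) : jetLift γ y 0 = 0 := by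
  simp [jetLift, hy0]

/-- The denominator `q(x, y(x, θ), θ)` along `y`. -/
noncomputable def denominatorAlong (γ : ℕ) (hq : AnalyticAt ℝ q 0) (hy : AnalyticAt ℝ y 0)
    (hy0 : y 0 = 0) : analyticSubring (ℝ × (Fin m → ℝ)) :=
  ⟨fun z => q (jetLift γ y z).1,
    hq.comp_of_eq (analyticAt_jetLift_fst hy) (congrArg Prod.fst (jetLift_zero hy0))⟩

theorem sliceTaylor_denominatorAlong_ne_zero (hq : AnalyticAt ℝ q 0)
    (hq0 : ¬ ∀ᶠ θ : Fin m → ℝ in 𝓝 0, q (0, 0, θ) = 0) (hy : AnalyticAt ℝ y 0)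
    (hy0 : ∀ᶠ θ : Fin m → ℝ in 𝓝 0, y (0, θ) = 0) :
    sliceTaylor (denominatorAlong γ hq hy hy0.self_of_nhds) ≠ 0 := by
  refine sliceTaylor_ne_zero fun h => hq0 ?_
  filter_upwards [h, hy0] with θ h1 h2
  have h3 : q (0, y (0, θ), θ) = 0 := h1
  rwa [h2] at h3

/-- The equation is given only where `q ≠ 0`, but `q` times the residual vanishes everywhere near
`0`. The series of `q` along `y` is nonzero, so it can be cancelled. -/
theorem IsAnalyticSolution.eventually_clearedResidual_eq_zero
    (hp : AnalyticAt ℝ p 0) (hq : AnalyticAt ℝ q 0)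
    (hq0 : ¬ ∀ᶠ θ : Fin m → ℝ in 𝓝 0, q (0, 0, θ) = 0) (hy : IsAnalyticSolution γ p q y)
    (hy0 : ∀ᶠ θ : Fin m → ℝ in 𝓝 0, y (0, θ) = 0) :
    ∀ᶠ z in 𝓝 0, clearedResidual p q (jetLift γ y z) = 0 := by
  have hlift := analyticAt_jetLift (γ := γ) hy.1
  have hzero : jetLift γ y 0 = 0 := jetLift_zero hy0.self_of_nhds
  have hres : AnalyticAt ℝ (fun z => clearedResidual p q (jetLift γ y z)) 0 :=
    (analyticAt_clearedResidual (v := 0) hp hq).comp_of_eq hlift hzero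
  let Q := denominatorAlong γ hq hy.1 hy0.self_of_nhds
  have hQ : sliceTaylor Q ≠ 0 := sliceTaylor_denominatorAlong_ne_zero hq hq0 hy.1 hy0
  have hcomp : ∀ i, ∀ᶠ z in 𝓝 0, clearedResidual p q (jetLift γ y z) i = 0 := by
    intro i
    refine eventually_eq_zero_of_sliceTaylor_eq_zero (f := analyticComponent _ hres i) ?_
    have hmul : sliceTaylor (Q * analyticComponent _ hres i) = 0 := by
      rw [← map_zero sliceTaylor]
      refine sliceTaylor_congr ?_
      filter_upwards [hy.2] with z hz
      change q (z.1, y z, z.2) * _ = 0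
      rw [mul_eq_zero, or_iff_not_imp_left]
      intro hne
      have := hz hne
      simp only [analyticComponent, clearedResidual, jetLift]
      rw [this, smul_inv_smul₀ hne, sub_self, Pi.zero_apply]
    rw [map_mul] at hmul
    exact (mul_eq_zero.1 hmul).resolve_left hQ
  filter_upwards [eventually_all.2 hcomp] with z hz using funext hz

/-- The linearised system satisfied, up to a quadratic error, by the difference of two
solutions. -/
theorem exists_linearization (hp : AnalyticAt ℝ p 0) (hq : AnalyticAt ℝ q 0)
    (hq0 : ¬ ∀ᶠ θ : Fin m → ℝ in 𝓝 0, q (0, 0, θ) = 0)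
    {yhat : ℝ × (Fin m → ℝ) → (Fin n → ℝ)} (hyhat : IsAnalyticSolution γ p q yhat)
    (hyhat0 : ∀ᶠ θ : Fin m → ℝ in 𝓝 0, yhat (0, θ) = 0) :
    ∃ D : PowerSeries (AnalyticGerm (Fin m → ℝ)), D ≠ 0 ∧
      ∃ M : Fin n → Fin n → PowerSeries (AnalyticGerm (Fin m → ℝ)),
        ∀ (y : ℝ × (Fin m → ℝ) → (Fin n → ℝ)) (hy : IsAnalyticSolution γ p q y),
          (∀ᶠ θ : Fin m → ℝ in 𝓝 0, y (0, θ) = 0) →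
          ∀ u : Fin n → PowerSeries (AnalyticGerm (Fin m → ℝ)),
            (∀ i, u i =
              sliceTaylor (analyticComponent y hy.1 i - analyticComponent yhat hyhat.1 i)) →
            ∀ N, (∀ i, PowerSeries.X ^ N ∣ u i) →
              ∀ i, PowerSeries.X ^ (2 * N) ∣
                D * PowerSeries.euler _ (u i) - ∑ j, M i j * u j := by
  have hlift := analyticAt_jetLift (γ := γ) hyhat.1
  have hzero : jetLift γ yhat 0 = 0 := jetLift_zero hyhat0.self_of_nhds
  set F := clearedResidual p q with hFdef
  have hF : AnalyticAt ℝ F 0 := analyticAt_clearedResidual (v := 0) hp hq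
  let Q := denominatorAlong γ hq hyhat.1 hyhat0.self_of_nhds
  have hQ : sliceTaylor Q ≠ 0 := sliceTaylor_denominatorAlong_ne_zero hq hq0 hyhat.1 hyhat0
  let e : Fin n → (ℝ × (Fin n → ℝ) × (Fin m → ℝ)) × (Fin n → ℝ) :=
    fun j => ((0, Pi.single j 1, 0), 0)
  have hdF : ∀ j, AnalyticAt ℝ (fun z => fderiv ℝ F (jetLift γ yhat z) (e j)) 0 := fun j =>
    ((ContinuousLinearMap.apply ℝ (Fin n → ℝ) (e j)).analyticAt _).comp
      (hF.fderiv.comp_of_eq hlift hzero)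
  let A : Fin n → Fin n → analyticSubring (ℝ × (Fin m → ℝ)) :=
    fun i j => analyticComponent _ (hdF j) i
  -- Here `D` is `q` along `yhat` times `X ^ γ`, since `x ^ (γ + 1) ∂ₓ` is `X ^ γ • euler`; `M` is
  -- minus the Jacobian of the residual in `y`.
  refine ⟨sliceTaylor Q * PowerSeries.X ^ γ,
    mul_ne_zero hQ (pow_ne_zero _ PowerSeries.X_ne_zero), fun i j => -sliceTaylor (A i j), ?_⟩
  intro y hy hy0 u hu N hN i
  let U : Fin n → analyticSubring (ℝ × (Fin m → ℝ)) :=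
    fun i => analyticComponent y hy.1 i - analyticComponent yhat hyhat.1 i
  let W : Fin n → analyticSubring (ℝ × (Fin m → ℝ)) :=
    fun i => analyticFst ^ (γ + 1) * derivFst (U i)
  have hTW : ∀ i, sliceTaylor (W i) = PowerSeries.X ^ γ * PowerSeries.euler _ (u i) := by
    intro i
    rw [map_mul, map_pow, sliceTaylor_analyticFst, sliceTaylor_derivFst, ← hu i,
      PowerSeries.euler_apply]
    ring
  have hL : sliceTaylor (Q * W i + ∑ j, A i j * U j) =
      sliceTaylor Q * PowerSeries.X ^ γ * PowerSeries.euler _ (u i) -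
        ∑ j, -sliceTaylor (A i j) * u j := by
    rw [map_add, map_mul, hTW, map_sum]
    simp only [map_mul, neg_mul, Finset.sum_neg_distrib, sub_neg_eq_add]
    rw [mul_assoc]
    congr 1
    exact Finset.sum_congr rfl fun j _ => by rw [hu j]
  rw [← hL, X_pow_dvd_sliceTaylor_iff]
  have hliftY := analyticAt_jetLift (γ := γ) hy.1
  have hzeroY : jetLift γ y 0 = 0 := jetLift_zero hy0.self_of_nhds
  -- the difference of the two lifts, expressed through `U` and `W`
  have hdiff : ∀ᶠ z in 𝓝 0, jetLift γ y z - jetLift γ yhat z =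
      ((0, fun j => (U j).1 z, 0), fun j => (W j).1 z) := by
    filter_upwards [eventually_deriv_apply hy.1, eventually_deriv_apply hyhat.1,
      hy.1.eventually_analyticAt, hyhat.1.eventually_analyticAt] with z h1 h2 h3 h4
    have hsub : ∀ j, (derivFst (U j)).1 z =
        deriv (fun x => y (x, z.2)) z.1 j - deriv (fun x => yhat (x, z.2)) z.1 j := by
      intro j
      rw [h1 j, h2 j]
      exact deriv_fun_sub (analyticAt_pi_iff.1 h3.slice j).differentiableAt
        (analyticAt_pi_iff.1 h4.slice j).differentiableAt
    refine Prod.ext (Prod.ext (sub_self _) (Prod.ext rfl (sub_self _))) (funext fun j => ?_)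
    change z.1 ^ (γ + 1) * _ - z.1 ^ (γ + 1) * _ = z.1 ^ (γ + 1) * (derivFst (U j)).1 z
    rw [hsub j, mul_sub]
  obtain ⟨C, hC⟩ := hF.exists_norm_sub_sub_fderiv_le
  have hpair : Tendsto (fun z => (jetLift γ yhat z, jetLift γ y z)) (𝓝 0) (𝓝 (0, 0)) := by
    have := hlift.continuousAt.tendsto.prodMk_nhds hliftY.continuousAt.tendsto
    rwa [hzero, hzeroY] at this
  have hpt : Tendsto (fun z => (jetLift γ yhat z).1) (𝓝 0) (𝓝 0) := by
    have := (analyticAt_jetLift_fst (γ := γ) hyhat.1).continuousAt.tendsto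
    rwa [hzero] at this
  have hbound : ∀ᶠ z in 𝓝 0, ‖(Q * W i + ∑ j, A i j * U j).1 z‖ ≤
      C * ‖jetLift γ y z - jetLift γ yhat z‖ ^ 2 := by
    filter_upwards [hdiff, hpair.eventually hC,
      hy.eventually_clearedResidual_eq_zero hp hq hq0 hy0,
      hyhat.eventually_clearedResidual_eq_zero hp hq hq0 hyhat0,
      hpt.eventually hp.eventually_analyticAt, hpt.eventually hq.eventually_analyticAt]
      with z h1 h2 h3 h4 h5 h6
    -- The residual vanishes on both lifts, so the Taylor remainder reduces to the linear term.
    refine le_trans ?_ h2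
    simp only [hFdef, h3, h4, sub_self, zero_sub, norm_neg]
    refine le_trans (le_of_eq ?_) (norm_le_pi_norm _ i)
    congr 1
    have hsplit : jetLift γ y z - jetLift γ yhat z =
        (0, fun j => (W j).1 z) + ∑ j, (U j).1 z • e j := by
      rw [h1]
      refine Prod.ext (Prod.ext ?_ (Prod.ext ?_ ?_)) ?_
      · simp [e, Prod.fst_sum]
      · ext l
        simp [e, Prod.fst_sum, Prod.snd_sum, Pi.single_apply]
      · simp [e, Prod.fst_sum, Prod.snd_sum]
      · simp [e, Prod.snd_sum]
    rw [hsplit, map_add, map_sum, fderiv_clearedResidual_snd h5 h6]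
    simp only [map_smul, Pi.add_apply, Pi.smul_apply, smul_eq_mul, Finset.sum_apply,
      Subring.coe_add, Subring.coe_mul, Pi.mul_apply, AddSubmonoidClass.coe_finsetSum]
    congr 1
    exact Finset.sum_congr rfl fun j _ => mul_comm _ _
  have hU : ∀ᶠ θ : Fin m → ℝ in 𝓝 0, ∀ j, (fun x => (U j).1 (x, θ)) =O[𝓝 0] fun x => x ^ N :=
    eventually_all.2 fun j => X_pow_dvd_sliceTaylor_iff.1 (by rw [← hu j]; exact hN j)
  have hW : ∀ᶠ θ : Fin m → ℝ in 𝓝 0, ∀ j, (fun x => (W j).1 (x, θ)) =O[𝓝 0] fun x => x ^ N :=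
    eventually_all.2 fun j => X_pow_dvd_sliceTaylor_iff.1 (by
      rw [hTW j]; exact (PowerSeries.X_pow_dvd_euler (hN j)).mul_left _)
  filter_upwards [hU, hW, hdiff.eventually_slice, hbound.eventually_slice] with θ h1 h2 h3 h4
  have h5 : (fun x => jetLift γ y (x, θ) - jetLift γ yhat (x, θ)) =O[𝓝 0] fun x => x ^ N := by
    refine Asymptotics.IsBigO.congr' (((Asymptotics.isBigO_zero _ _).prod_left
      ((Asymptotics.isBigO_pi.2 h1).prod_left (Asymptotics.isBigO_zero _ _))).prod_left
        (Asymptotics.isBigO_pi.2 h2)) ?_ EventuallyEq.rfl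
    filter_upwards [h3] with x hx using hx.symm
  have h6 : (fun x => (Q * W i + ∑ j, A i j * U j).1 (x, θ)) =O[𝓝 0]
      fun x => ‖jetLift γ y (x, θ) - jetLift γ yhat (x, θ)‖ ^ 2 := by
    refine Asymptotics.IsBigO.of_bound C ?_
    filter_upwards [h4] with x hx
    simpa using hx
  refine h6.trans ((h5.norm_left.pow 2).congr_right fun x => ?_)
  ring

end Equation

/-! ### Conclusion: comparison of the two orders. -/

theorem theorem5p1 (n m γ : ℕ)
    (p : ℝ × (Fin n → ℝ) × (Fin m → ℝ) → (Fin n → ℝ))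
    (q : ℝ × (Fin n → ℝ) × (Fin m → ℝ) → ℝ)
    (hp : AnalyticAt ℝ p (0, 0, 0))
    (hq : AnalyticAt ℝ q (0, 0, 0))
    (hq0 : ¬ ∀ᶠ θ : Fin m → ℝ in 𝓝 0, q (0, 0, θ) = 0)
    (yhat : ℝ × (Fin m → ℝ) → (Fin n → ℝ))
    (hyhat : IsAnalyticSolution γ p q yhat)
    (hyhat0 : ∀ᶠ θ : Fin m → ℝ in 𝓝 0, yhat (0, θ) = 0) :
    ∃ k : ℕ, ∀ y : ℝ × (Fin m → ℝ) → (Fin n → ℝ),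
      IsAnalyticSolution γ p q y →
      (∀ l : ℕ, l ≤ k → ∀ᶠ θ : Fin m → ℝ in 𝓝 0,
        iteratedDeriv l (fun x : ℝ => y (x, θ)) 0 =
          iteratedDeriv l (fun x : ℝ => yhat (x, θ)) 0) →
      ∀ᶠ z : ℝ × (Fin m → ℝ) in 𝓝 (0, 0), y z = yhat z := by
  classical
  obtain ⟨D, hD, M, hM⟩ := exists_linearization hp hq hq0 hyhat hyhat0
  obtain ⟨K, hK⟩ := PowerSeries.exists_order_bound D hD M
  refine ⟨K, fun y hy hjet => ?_⟩
  have hy0 : ∀ᶠ θ : Fin m → ℝ in 𝓝 0, y (0, θ) = 0 := by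
    filter_upwards [hjet 0 (Nat.zero_le K), hyhat0] with θ h1 h2
    simpa [h2] using h1
  let U : Fin n → analyticSubring (ℝ × (Fin m → ℝ)) :=
    fun i => analyticComponent y hy.1 i - analyticComponent yhat hyhat.1 i
  have hcoeff : ∀ N i, PowerSeries.coeff N (sliceTaylor (U i)) = 0 := by
    by_contra! hex
    have hmin : ∀ l < Nat.find hex, ∀ i, PowerSeries.coeff l (sliceTaylor (U i)) = 0 := by
      intro l hl
      simpa using Nat.find_min hex hl
    obtain ⟨i, hi⟩ := Nat.find_spec hex
    set N := Nat.find hex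
    have hKN : K < N := by
      by_contra! hle
      exact hi (coeff_sliceTaylor_analyticComponent_sub hy.1 hyhat.1 i N (hjet N hle))
    have hdvd : ∀ i, PowerSeries.X ^ N ∣ sliceTaylor (U i) := fun i =>
      PowerSeries.X_pow_dvd_iff.2 fun l hl => hmin l hl i
    -- The quadratic error allows `r = 2 * N`, so `2 * N ≤ N + K`, against `K < N`.
    have := hK N (2 * N) (fun i => sliceTaylor (U i)) hKN.le
      ⟨i, hdvd i, fun h => hi (PowerSeries.X_pow_dvd_iff.1 h N (Nat.lt_succ_self N))⟩
      (hM y hy hy0 _ (fun _ => rfl) N hdvd)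
    omega
  have hcomp : ∀ i, ∀ᶠ z in 𝓝 0, (U i).1 z = 0 := fun i =>
    eventually_eq_zero_of_sliceTaylor_eq_zero (PowerSeries.ext fun l => by simp [hcoeff l i])
  filter_upwards [eventually_all.2 hcomp] with z hz
  exact funext fun i => sub_eq_zero.1 (hz i)
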